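/- Let $A$ be a transcendental entire function. Suppose that $A^{-1}$ has a logarithmic singularity over $\infty$, that is: there is a path $\gamma:[0,\infty)\to\mathbb{C}$ tending to infinity with $A(z)\to\infty$ as $z\to\infty$ on $\gamma$ and, writing $\Omega_M$ for $M>0$ for the connected component of $\{z\in\mathbb{C}:|A(z)|>M\}$ such that $\gamma\setminus\Omega_M$ is bounded (the sets $\Omega_M$ are called the neighbourhoods of the singularity), there exists $M_0>0$ such that an analytic branch of $w=\log A(z)$ maps $\Omega_{M_0}$ univalently onto the half-plane $\operatorname{Re} w>\log M_0$. Then for every $M>0$ there exists a path $\Gamma\subseteq\Omega_M$ tending to infinity such that every solution $y$ of $$y''+A(z)y=0$$ in $\mathbb{C}$ satisfies $y(z)\to 0$ as $z\to\infty$ on $\Gamma$. -/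

import Mathlib

open Filter Topology
open scoped NNReal

/-- An entire function `ℂ → ℂ` that is not a polynomial. -/
def IsTranscendentalEntire (f : ℂ → ℂ) : Prop :=
  Differentiable ℂ f ∧ ¬ ∃ p : Polynomial ℂ, ∀ z, f z = p.eval z

/-- A path `[0, ∞) → ℂ` tending to infinity. -/
def IsPathToInfinity (γ : ℝ≥0 → ℂ) : Prop :=
  Continuous γ ∧ Tendsto γ atTop (Bornology.cobounded ℂ)

/-- `γ` is a path tending to infinity on which `f` tends to infinity: it determines a
transcendental singularity of `f⁻¹` over the asymptotic value `∞`. -/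
def DeterminesSingularityOverInfinity (f : ℂ → ℂ) (γ : ℝ≥0 → ℂ) : Prop :=
  IsPathToInfinity γ ∧ Tendsto (fun t => f (γ t)) atTop (Bornology.cobounded ℂ)

/-- `Ω` is the neighbourhood, with parameter `M > 0`, of the singularity over `∞` of the inverse
of the entire function `f` determined by `γ`: a connected component of `{z | M < |f z|}` outside
of which only a bounded part of `γ` lies. -/
def IsSingularityNhd (f : ℂ → ℂ) (γ : ℝ≥0 → ℂ) (M : ℝ) (Ω : Set ℂ) : Prop :=
  0 < M ∧ (∃ z₀ ∈ {z : ℂ | M < ‖f z‖}, Ω = connectedComponentIn {z : ℂ | M < ‖f z‖} z₀) ∧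
    Bornology.IsBounded (Set.range γ \ Ω)

/-- The singularity over `∞` determined by `γ` is logarithmic: for some `M > 0` an analytic branch
of `log f` maps the neighbourhood with parameter `M` univalently onto `{w | log M < Re w}`.
(As `f` is entire it has no poles, so the singularity is automatically direct.) -/
def IsLogarithmicSingularity (f : ℂ → ℂ) (γ : ℝ≥0 → ℂ) : Prop :=
  DeterminesSingularityOverInfinity f γ ∧
    ∃ (M : ℝ) (Ω : Set ℂ), IsSingularityNhd f γ M Ω ∧
      ∃ L : ℂ → ℂ, DifferentiableOn ℂ L Ω ∧ (∀ z ∈ Ω, Complex.exp (L z) = f z) ∧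
        Set.BijOn L Ω {w : ℂ | Real.log M < w.re}

/-- `y` is an (entire) solution of `y'' + A y = 0`. -/
def IsSolution (A y : ℂ → ℂ) : Prop :=
  Differentiable ℂ y ∧ ∀ z, deriv (deriv y) z + A z * y z = 0

/-!
Let `φ` be the inverse on `{w | a < Re w}` of the branch `w` of `log A`, and write
`φ' = e^{h - w/2}`, so that `e^h dw` is `√A dz`. Since `φ` is univalent on the disc of radius
`Re w - a` about `w`, the distortion bound `|φ''/φ'| ≤ const / (Re w - a)` shows that `h' → 1/2`
as `Re w → ∞`. Hence some unit speed curve on which `e^h dw` is positive moves to the right forever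
and `|e^h|` grows exponentially along it. In the coordinate `ζ = ∫ e^h dw` the Liouville
transform `U = A^{1/4} y` of a solution satisfies `d²U/dζ² + (1 + q) U = 0` with `q = O(e^{-2h})`
integrable along the curve. On the curve `dζ` is real, so `U` is bounded there, and
`y = A^{-1/4} U → 0`.
-/

theorem not_eventually_eq_of_injOn {X Y : Type*} [TopologicalSpace X] {f : X → Y} {U : Set X}
    {x : X} [(𝓝[≠] x).NeBot] (hU : U ∈ 𝓝 x) (hinj : Set.InjOn f U) :
    ¬∀ᶠ y in 𝓝 x, f y = f x := by
  intro hconst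
  have hfalse : ∀ᶠ _ in 𝓝[≠] x, False := by
    filter_upwards [nhdsWithin_le_nhds hconst, nhdsWithin_le_nhds hU, self_mem_nhdsWithin]
      with _ hyx hyU hne using hne (hinj hyU (mem_of_mem_nhds hU) hyx)
  exact hfalse.exists.elim fun _ h => h

section Univalent

variable {f g : ℂ → ℂ} {U : Set ℂ} {z : ℂ}

theorem nhds_le_map_nhds_of_injOn (hf : DifferentiableOn ℂ f U) (hinj : Set.InjOn f U)
    (hU : U ∈ 𝓝 z) : 𝓝 (f z) ≤ map f (𝓝 z) :=
  (hf.analyticAt hU).eventually_constant_or_nhds_le_map_nhds.resolve_left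
    (not_eventually_eq_of_injOn hU hinj)

theorem isOpen_image_of_injOn (hU : IsOpen U) (hf : DifferentiableOn ℂ f U)
    (hinj : Set.InjOn f U) : IsOpen (f '' U) := by
  rw [isOpen_iff_mem_nhds]
  rintro _ ⟨z, hz, rfl⟩
  exact nhds_le_map_nhds_of_injOn hf hinj (hU.mem_nhds hz) (image_mem_map (hU.mem_nhds hz))

theorem continuousAt_of_leftInvOn (hf : DifferentiableOn ℂ f U) (hg : Set.LeftInvOn g f U)
    (hU : U ∈ 𝓝 z) : ContinuousAt g (f z) := by
  have hgf : Tendsto g (map f (𝓝 z)) (𝓝 z) :=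
    tendsto_map'_iff.2 (tendsto_id.congr' (hg.eqOn.symm.eventuallyEq_of_mem hU))
  rw [ContinuousAt, hg (mem_of_mem_nhds hU)]
  exact hgf.mono_left (nhds_le_map_nhds_of_injOn hf hg.injOn hU)

theorem eventually_deriv_ne_zero_of_injOn (hf : DifferentiableOn ℂ f U) (hinj : Set.InjOn f U)
    (hU : U ∈ 𝓝 z) : ∀ᶠ ζ in 𝓝[≠] z, deriv f ζ ≠ 0 := by
  refine (hf.analyticAt hU).deriv.eventually_eq_zero_or_eventually_ne_zero.resolve_left
    fun hzero => not_eventually_eq_of_injOn hU hinj ?_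
  obtain ⟨r, hr, hball⟩ := Metric.mem_nhds_iff.1 (hzero.and hU)
  filter_upwards [Metric.ball_mem_nhds z hr] with ζ hζ
  exact Metric.isOpen_ball.is_const_of_deriv_eq_zero (convex_ball z r).isPreconnected
    (hf.mono fun x hx => (hball hx).2) (fun x hx => (hball hx).1) hζ (Metric.mem_ball_self hr)

/-- Near `f z` the inverse is differentiable where the derivative of `f` does not vanish, hence off
an isolated point, and that singularity is removable since the inverse is continuous. -/
theorem differentiableAt_of_leftInvOn (hU : IsOpen U) (hf : DifferentiableOn ℂ f U)
    (hg : Set.LeftInvOn g f U) (hz : z ∈ U) : DifferentiableAt ℂ g (f z) := by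
  have himage : ∀ ζ ∈ U, f '' U ∈ 𝓝 (f ζ) := fun ζ hζ =>
    (isOpen_image_of_injOn hU hf hg.injOn).mem_nhds (Set.mem_image_of_mem f hζ)
  have hcont : ∀ ζ ∈ U, ContinuousAt g (f ζ) := fun ζ hζ =>
    continuousAt_of_leftInvOn hf hg (hU.mem_nhds hζ)
  have hright : Set.LeftInvOn f g (f '' U) := by
    rintro _ ⟨ζ, hζ, rfl⟩
    rw [hg hζ]
  have hpunctured : Tendsto g (𝓝[≠] f z) (𝓝[≠] z) := by
    refine tendsto_nhdsWithin_iff.2 ⟨?_, ?_⟩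
    · simpa only [ContinuousAt, hg hz] using (hcont z hz).mono_left nhdsWithin_le_nhds
    · filter_upwards [nhdsWithin_le_nhds (himage z hz), self_mem_nhdsWithin] with w hw hne hgw
      exact hne (by rw [← hright hw, Set.mem_singleton_iff.1 hgw, Set.mem_singleton_iff])
  refine (Complex.analyticAt_of_differentiable_on_punctured_nhds_of_continuousAt ?_
    (hcont z hz)).differentiableAt
  filter_upwards [hpunctured.eventually (eventually_deriv_ne_zero_of_injOn hf hg.injOn
    (hU.mem_nhds hz)), nhdsWithin_le_nhds (himage z hz)]
  rintro _ hderiv ⟨ζ, hζ, rfl⟩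
  refine (HasDerivAt.of_local_left_inverse (hcont ζ hζ)
    (hf.hasDerivAt (by rw [hg hζ]; exact hU.mem_nhds hζ)) hderiv ?_).differentiableAt
  filter_upwards [himage ζ hζ] with w hw using hright hw

theorem deriv_mul_deriv_eq_one_of_leftInvOn (hU : IsOpen U) (hf : DifferentiableOn ℂ f U)
    (hg : Set.LeftInvOn g f U) (hz : z ∈ U) : deriv g (f z) * deriv f z = 1 := by
  have hcomp := (differentiableAt_of_leftInvOn hU hf hg hz).hasDerivAt.comp z
    (hf.hasDerivAt (hU.mem_nhds hz))
  exact hcomp.unique ((hasDerivAt_id z).congr_of_eventuallyEq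
    (hg.eqOn.eventuallyEq_of_mem (hU.mem_nhds hz)))

theorem deriv_ne_zero_of_injOn (hU : IsOpen U) (hf : DifferentiableOn ℂ f U)
    (hinj : Set.InjOn f U) (hz : z ∈ U) : deriv f z ≠ 0 :=
  right_ne_zero_of_mul_eq_one
    (deriv_mul_deriv_eq_one_of_leftInvOn hU hf hinj.leftInvOn_invFunOn hz)

end Univalent

section Logarithm

theorem hasDerivAt_of_exp_comp_eventuallyEq {f g : ℂ → ℂ} {f' z : ℂ} (hf : HasDerivAt f f' z)
    (hg : ContinuousAt g z) (hexp : ∀ᶠ ζ in 𝓝 z, Complex.exp (g ζ) = f ζ) :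
    HasDerivAt g (f' / f z) z := by
  have hstrict := Complex.hasStrictDerivAt_exp (g z)
  have hinv := hstrict.to_localInverse (Complex.exp_ne_zero _)
  refine ((hinv.hasDerivAt.comp_of_eq z hf hexp.self_of_nhds).congr_of_eventuallyEq
    ?_).congr_deriv (by rw [hexp.self_of_nhds, inv_mul_eq_div])
  filter_upwards [hexp, hg.eventually
    (hstrict.eventually_left_inverse (Complex.exp_ne_zero _))] with ζ hζ hleft
  rw [Function.comp_apply, ← hζ, hleft]

theorem exists_differentiableOn_exp_eq {f : ℂ → ℂ} {U : Set ℂ} (hU : IsOpen U)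
    (hsc : IsSimplyConnected U) (hf : DifferentiableOn ℂ f U) (hne : ∀ z ∈ U, f z ≠ 0) :
    ∃ g : ℂ → ℂ, DifferentiableOn ℂ g U ∧ ∀ z ∈ U, Complex.exp (g z) = f z := by
  obtain ⟨g, hgc, hg⟩ := Complex.exists_continuousOn_eqOn_exp_comp hsc hU hf.continuousOn
    fun ⟨z, hz, hzero⟩ => hne z hz hzero
  refine ⟨g, fun z hz => ?_, fun z hz => hg hz⟩
  have hUz := hU.mem_nhds hz
  exact (hasDerivAt_of_exp_comp_eventuallyEq (hf.hasDerivAt hUz) (hgc.continuousAt hUz)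
    (hg.eventuallyEq_of_mem hUz)).differentiableAt.differentiableWithinAt

theorem isSimplyConnected_of_convex {E : Type*} [AddCommGroup E] [Module ℝ E]
    [TopologicalSpace E] [ContinuousAdd E] [ContinuousSMul ℝ E] {U : Set E} (hU : Convex ℝ U)
    (hne : U.Nonempty) : IsSimplyConnected U := by
  have := hU.contractibleSpace hne
  exact (inferInstance : SimplyConnectedSpace U)

end Logarithm

section Distortion

theorem le_mul_norm_deriv_of_ball_subset_image {f : ℂ → ℂ} {c : ℂ} {R d : ℝ} (hR : 0 < R)
    (hf : DifferentiableOn ℂ f (Metric.ball c R)) (hinj : Set.InjOn f (Metric.ball c R))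
    (hd : 0 < d) (hsub : Metric.ball (f c) d ⊆ f '' Metric.ball c R) :
    d ≤ R * ‖deriv f c‖ := by
  have hc : c ∈ Metric.ball c R := Metric.mem_ball_self hR
  have hinv := hinj.leftInvOn_invFunOn
  set g := Function.invFunOn f (Metric.ball c R)
  have hg : DifferentiableOn ℂ g (Metric.ball (f c) d) := by
    intro w hw
    obtain ⟨z, hz, rfl⟩ := hsub hw
    exact (differentiableAt_of_leftInvOn Metric.isOpen_ball hf hinv hz).differentiableWithinAt
  have hmaps : Set.MapsTo g (Metric.ball (f c) d) (Metric.closedBall (g (f c)) R) := by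
    intro w hw
    obtain ⟨z, hz, rfl⟩ := hsub hw
    rw [hinv hz, hinv hc]
    exact Metric.ball_subset_closedBall hz
  have hschwarz := Complex.norm_deriv_le_div_of_mapsTo_ball hg hmaps hd
  have hderiv := congrArg norm (deriv_mul_deriv_eq_one_of_leftInvOn Metric.isOpen_ball hf hinv hc)
  rw [norm_mul, norm_one] at hderiv
  rw [le_div_iff₀ hd] at hschwarz
  calc d = ‖deriv g (f c)‖ * d * ‖deriv f c‖ := by linear_combination (-d) * hderiv
    _ ≤ R * ‖deriv f c‖ := by gcongr

theorem exists_notMem_image_ball_subset_image {f : ℂ → ℂ} {c : ℂ} {R : ℝ} (hR : 0 < R)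
    (hf : DifferentiableOn ℂ f (Metric.ball c R)) (hinj : Set.InjOn f (Metric.ball c R)) :
    ∃ ω, ω ∉ f '' Metric.ball c R ∧ Metric.ball (f c) ‖f c - ω‖ ⊆ f '' Metric.ball c R := by
  have hne : (f '' Metric.ball c R)ᶜ.Nonempty := by
    by_contra! hempty
    rw [Set.compl_empty_iff] at hempty
    have hle := le_mul_norm_deriv_of_ball_subset_image hR hf hinj
      (d := R * ‖deriv f c‖ + 1) (by positivity) (hempty ▸ Set.subset_univ _)
    linarith
  obtain ⟨ω, hω, hdist⟩ := (isOpen_image_of_injOn Metric.isOpen_ball hf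
    hinj).isClosed_compl.exists_infDist_eq_dist hne (f c)
  refine ⟨ω, hω, ?_⟩
  rw [← dist_eq_norm, ← hdist]
  exact Metric.ball_infDist_compl_subset

theorem norm_sq_sub_one_lt_one {u : ℂ} (hu : ‖u + 1‖ < 2 / 5) : ‖u ^ 2 - 1‖ < 1 := by
  have hsub : ‖u - 1‖ ≤ ‖u + 1‖ + 2 := by
    simpa [add_sub_assoc, show (1 : ℂ) - 2 = -1 by norm_num, ← sub_eq_add_neg]
      using norm_sub_le (u + 1) 2
  rw [show u ^ 2 - 1 = (u + 1) * (u - 1) by ring, norm_mul]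
  nlinarith [norm_nonneg (u + 1)]

theorem re_ne_zero_of_norm_sq_sub_one_lt_one {u : ℂ} (hu : ‖u ^ 2 - 1‖ < 1) : u.re ≠ 0 := by
  intro hre
  have hsq : (u ^ 2 - 1).re = -u.im ^ 2 - 1 := by simp [pow_two, hre]
  have habs := (Complex.abs_re_le_norm (u ^ 2 - 1)).trans_lt hu
  rw [hsq, abs_lt] at habs
  nlinarith [sq_nonneg u.im]

theorem re_pos_of_isPreconnected {X : Type*} [TopologicalSpace X] {S : Set X} {g : X → ℂ} {c : X}
    (hS : IsPreconnected S) (hg : ContinuousOn g S) (hsq : ∀ x ∈ S, ‖g x ^ 2 - 1‖ < 1)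
    (hc : c ∈ S) (hgc : g c = 1) : ∀ x ∈ S, 0 < (g x).re := by
  intro x hx
  by_contra! hneg
  obtain ⟨y, hy, hzero⟩ := hS.intermediate_value hx hc
    (Complex.continuous_re.comp_continuousOn hg) ⟨hneg, by simp [hgc]⟩
  exact re_ne_zero_of_norm_sq_sub_one_lt_one (hsq y hy) hzero

theorem isPreconnected_preimage_of_injOn {f : ℂ → ℂ} {U V : Set ℂ} (hU : IsOpen U)
    (hf : DifferentiableOn ℂ f U) (hinj : Set.InjOn f U) (hV : IsPreconnected V)
    (hVU : V ⊆ f '' U) : IsPreconnected (U ∩ f ⁻¹' V) := by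
  have hinv := hinj.leftInvOn_invFunOn
  set F := Function.invFunOn f U
  have himage : F '' V = U ∩ f ⁻¹' V := by
    ext z
    refine ⟨?_, fun ⟨hzU, hzV⟩ => ⟨f z, hzV, hinv hzU⟩⟩
    rintro ⟨w, hw, rfl⟩
    obtain ⟨ζ, hζ, rfl⟩ := hVU hw
    rw [hinv hζ]
    exact ⟨hζ, hw⟩
  rw [← himage]
  refine hV.image F fun w hw => ?_
  obtain ⟨z, hz, rfl⟩ := hVU hw
  exact (continuousAt_of_leftInvOn hf hinv (hU.mem_nhds hz)).continuousWithinAt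

theorem exists_differentiableOn_sq_eq {f : ℂ → ℂ} {U : Set ℂ} (hU : IsOpen U)
    (hsc : IsSimplyConnected U) (hf : DifferentiableOn ℂ f U) (hne : ∀ z ∈ U, f z ≠ 0) {c : ℂ}
    (hc : c ∈ U) : ∃ g : ℂ → ℂ, DifferentiableOn ℂ g U ∧ g c = 1 ∧
      ∀ z ∈ U, f z = f c * g z ^ 2 := by
  obtain ⟨ℓ, hℓ, hexp⟩ := exists_differentiableOn_exp_eq hU hsc hf hne
  refine ⟨fun z => Complex.exp ((ℓ z - ℓ c) / 2), ((hℓ.sub_const _).div_const _).cexp, by simp,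
    fun z hz => ?_⟩
  rw [← hexp z hz, ← hexp c hc, ← Complex.exp_nat_mul, ← Complex.exp_add]
  congr 1
  push_cast
  ring

/-- The square root of `f - ω`, with `ω` omitted by `f`, cannot take values near both `1` and `-1`,
since its square is injective. -/
theorem exists_eq_add_mul_sq_sub_one_of_injOn_ball {f : ℂ → ℂ} {c : ℂ} {R : ℝ} (hR : 0 < R)
    (hf : DifferentiableOn ℂ f (Metric.ball c R)) (hinj : Set.InjOn f (Metric.ball c R)) :
    ∃ (D : ℂ) (g : ℂ → ℂ), ‖D‖ ≤ R * ‖deriv f c‖ ∧ DifferentiableOn ℂ g (Metric.ball c R) ∧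
      g c = 1 ∧ ∀ z ∈ Metric.ball c R, f z = f c + D * (g z ^ 2 - 1) ∧ 2 / 5 ≤ ‖g z + 1‖ := by
  have hc : c ∈ Metric.ball c R := Metric.mem_ball_self hR
  obtain ⟨ω, hω, hsub⟩ := exists_notMem_image_ball_subset_image hR hf hinj
  have hne : ∀ z ∈ Metric.ball c R, f z - ω ≠ 0 := fun z hz hzero =>
    hω ⟨z, hz, sub_eq_zero.1 hzero⟩
  have hD : 0 < ‖f c - ω‖ := norm_pos_iff.2 (hne c hc)
  obtain ⟨g, hg, hgc, hsq⟩ := exists_differentiableOn_sq_eq Metric.isOpen_ball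
    (isSimplyConnected_of_convex (convex_ball c R) ⟨c, hc⟩) (hf.sub_const ω) hne hc
  have heq : ∀ z ∈ Metric.ball c R, f z = f c + (f c - ω) * (g z ^ 2 - 1) := fun z hz => by
    linear_combination hsq z hz
  have hmem : ∀ z ∈ Metric.ball c R,
      (f z ∈ Metric.ball (f c) ‖f c - ω‖ ↔ ‖g z ^ 2 - 1‖ < 1) := fun z hz => by
    rw [mem_ball_iff_norm, heq z hz, add_sub_cancel_left, norm_mul, mul_lt_iff_lt_one_right hD]
  have hpre := isPreconnected_preimage_of_injOn Metric.isOpen_ball hf hinj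
    (convex_ball (f c) ‖f c - ω‖).isPreconnected hsub
  have hre := re_pos_of_isPreconnected hpre (hg.continuousOn.mono Set.inter_subset_left)
    (fun z hz => (hmem z hz.1).1 hz.2) ⟨hc, Metric.mem_ball_self hD⟩ hgc
  refine ⟨f c - ω, g, le_mul_norm_deriv_of_ball_subset_image hR hf hinj hD hsub, hg, hgc,
    fun z hz => ⟨heq z hz, ?_⟩⟩
  by_contra! hnear
  have hpos := hre z ⟨hz, (hmem z hz).2 (norm_sq_sub_one_lt_one hnear)⟩
  have hle := Complex.re_le_norm (g z + 1)
  simp only [Complex.add_re, Complex.one_re] at hle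
  linarith

theorem deriv_deriv_inv {k : ℂ → ℂ} {c : ℂ} (hk : AnalyticAt ℂ k c) (hkc : k c ≠ 0) :
    deriv (deriv k⁻¹) c = 2 * deriv k c ^ 2 / k c ^ 3 - deriv (deriv k) c / k c ^ 2 := by
  have hfst : deriv k⁻¹ =ᶠ[𝓝 c] fun z => -deriv k z / k z ^ 2 := by
    filter_upwards [hk.eventually_analyticAt, hk.continuousAt.eventually_ne hkc] with z hz hne
    exact (hz.differentiableAt.hasDerivAt.inv hne).deriv
  have hsnd : HasDerivAt (fun z => -deriv k z / k z ^ 2) _ c :=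
    hk.deriv.differentiableAt.hasDerivAt.fun_neg.fun_div
      (hk.differentiableAt.hasDerivAt.fun_pow 2) (pow_ne_zero 2 hkc)
  rw [hfst.deriv_eq, hsnd.deriv]
  push_cast
  field_simp
  ring

theorem norm_deriv_le_and_norm_deriv_deriv_le_of_norm_le {k : ℂ → ℂ} {c : ℂ} {R B : ℝ}
    (hR : 0 < R) (hk : DifferentiableOn ℂ k (Metric.ball c R))
    (hB : ∀ z ∈ Metric.ball c R, ‖k z‖ ≤ B) :
    ‖deriv k c‖ ≤ 2 * B / R ∧ ‖deriv (deriv k) c‖ ≤ 8 * B / R ^ 2 := by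
  have hsub : Metric.closedBall c (R / 2) ⊆ Metric.ball c R :=
    Metric.closedBall_subset_ball (half_lt_self hR)
  have hcl : DiffContOnCl ℂ k (Metric.ball c (R / 2)) :=
    (hk.mono hsub).diffContOnCl_ball subset_rfl
  have hsphere : ∀ z ∈ Metric.sphere c (R / 2), ‖k z‖ ≤ B := fun z hz =>
    hB z (hsub (Metric.sphere_subset_closedBall hz))
  constructor
  · exact (Complex.norm_deriv_le_of_forall_mem_sphere_norm_le (by positivity) hcl
      hsphere).trans_eq (by field_simp)
  · have hcauchy :=
      Complex.norm_iteratedDeriv_le_of_forall_mem_sphere_norm_le 2 (by positivity) hcl hsphere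
    rw [iteratedDeriv_succ, iteratedDeriv_one] at hcauchy
    refine hcauchy.trans_eq ?_
    norm_num [Nat.factorial]
    field_simp
    ring

theorem norm_deriv_le_and_norm_deriv_deriv_le_of_le_norm {q : ℂ → ℂ} {c : ℂ} {R δ : ℝ}
    (hR : 0 < R) (hδ : 0 < δ) (hq : DifferentiableOn ℂ q (Metric.ball c R))
    (hle : ∀ z ∈ Metric.ball c R, δ ≤ ‖q z‖) :
    ‖deriv q c‖ ≤ 2 * ‖q c‖ ^ 2 / (δ * R) ∧
      ‖deriv (deriv q) c‖ ≤ 8 * ‖q c‖ ^ 3 / (δ * R) ^ 2 + 8 * ‖q c‖ ^ 2 / (δ * R ^ 2) := by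
  have hc : Metric.ball c R ∈ 𝓝 c := Metric.ball_mem_nhds c hR
  have hne : ∀ z ∈ Metric.ball c R, q z ≠ 0 := fun z hz => norm_pos_iff.1 (hδ.trans_le (hle z hz))
  have hqc : q⁻¹ c ≠ 0 := inv_ne_zero (hne c (mem_of_mem_nhds hc))
  have hinv : DifferentiableOn ℂ q⁻¹ (Metric.ball c R) := hq.inv hne
  obtain ⟨hinv', hinv''⟩ := norm_deriv_le_and_norm_deriv_deriv_le_of_norm_le hR hinv
    (B := δ⁻¹) fun z hz => by
      rw [Pi.inv_apply, norm_inv]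
      exact inv_anti₀ hδ (hle z hz)
  have hfst : deriv q c = -deriv q⁻¹ c * q c ^ 2 := by
    simpa only [inv_inv, Pi.inv_apply, inv_pow, div_inv_eq_mul]
      using ((hinv.hasDerivAt hc).inv hqc).deriv
  have hsnd : deriv (deriv q) c =
      2 * deriv q⁻¹ c ^ 2 * q c ^ 3 - deriv (deriv q⁻¹) c * q c ^ 2 := by
    simpa only [inv_inv, Pi.inv_apply, inv_pow, div_inv_eq_mul]
      using deriv_deriv_inv (hinv.analyticAt hc) hqc
  constructor
  · rw [hfst, norm_mul, norm_neg, norm_pow]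
    calc _ ≤ 2 * δ⁻¹ / R * ‖q c‖ ^ 2 := by gcongr
      _ = _ := by field_simp
  · rw [hsnd]
    calc _ ≤ 2 * ‖deriv q⁻¹ c‖ ^ 2 * ‖q c‖ ^ 3 + ‖deriv (deriv q⁻¹) c‖ * ‖q c‖ ^ 2 :=
          (norm_sub_le _ _).trans_eq (by simp)
      _ ≤ 2 * (2 * δ⁻¹ / R) ^ 2 * ‖q c‖ ^ 3 + 8 * δ⁻¹ / R ^ 2 * ‖q c‖ ^ 2 := by gcongr
      _ = _ := by
        field_simp
        ring

/-- A weak form of Bieberbach's estimate of the second coefficient of a univalent function, whose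
sharp constant is `4`. -/
theorem norm_deriv_deriv_le_of_injOn_ball {f : ℂ → ℂ} {c : ℂ} {R : ℝ} (hR : 0 < R)
    (hf : DifferentiableOn ℂ f (Metric.ball c R)) (hinj : Set.InjOn f (Metric.ball c R)) :
    ‖deriv (deriv f) c‖ ≤ 1760 / R * ‖deriv f c‖ := by
  have hc : Metric.ball c R ∈ 𝓝 c := Metric.ball_mem_nhds c hR
  obtain ⟨D, g, hD, hg, hgc, hfg⟩ := exists_eq_add_mul_sq_sub_one_of_injOn_ball hR hf hinj
  have hfst : deriv f =ᶠ[𝓝 c] fun z => 2 * D * (g z * deriv g z) := by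
    filter_upwards [Metric.isOpen_ball.mem_nhds (mem_of_mem_nhds hc)] with z hz
    have hball := Metric.isOpen_ball.mem_nhds hz
    have heq : f =ᶠ[𝓝 z] fun ζ => f c + D * (g ζ ^ 2 - 1) :=
      eventuallyEq_of_mem hball fun ζ hζ => (hfg ζ hζ).1
    rw [heq.deriv_eq, ((((hg.hasDerivAt hball).fun_pow 2).sub_const 1).const_mul
      D |>.const_add (f c)).deriv]
    push_cast
    ring
  have hsnd : deriv (deriv f) c = 2 * D * (deriv g c ^ 2 + deriv (deriv g) c) := by
    have hgg := (hg.analyticAt hc).deriv.differentiableAt.hasDerivAt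
    rw [hfst.deriv_eq, (((hg.hasDerivAt hc).fun_mul hgg).const_mul (2 * D)).deriv, hgc]
    ring
  obtain ⟨hg', hg''⟩ := norm_deriv_le_and_norm_deriv_deriv_le_of_le_norm hR
    (by norm_num) (hg.add_const 1) fun z hz => (hfg z hz).2
  simp only [deriv_add_const', hgc, one_add_one_eq_two, Complex.norm_ofNat] at hg' hg''
  calc ‖deriv (deriv f) c‖ ≤ 2 * ‖D‖ * (‖deriv g c‖ ^ 2 + ‖deriv (deriv g) c‖) := by
        rw [hsnd, norm_mul, norm_mul, Complex.norm_ofNat, ← norm_pow]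
        gcongr
        exact norm_add_le _ _
    _ ≤ 2 * (R * ‖deriv f c‖) * ((2 * 2 ^ 2 / (2 / 5 * R)) ^ 2 +
          (8 * 2 ^ 3 / (2 / 5 * R) ^ 2 + 8 * 2 ^ 2 / (2 / 5 * R ^ 2))) := by gcongr
    _ = 1760 / R * ‖deriv f c‖ := by
        field_simp
        ring

theorem exists_hasDerivAt_exp_sub_half {φ : ℂ → ℂ} {a : ℝ}
    (hφ : DifferentiableOn ℂ φ {w | a < w.re}) (hinj : Set.InjOn φ {w | a < w.re}) :
    ∃ h : ℂ → ℂ, ∀ w : ℂ, a < w.re → HasDerivAt φ (Complex.exp (h w - w / 2)) w ∧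
      DifferentiableAt ℂ h w ∧ ‖deriv h w - 1 / 2‖ ≤ 1760 / (w.re - a) := by
  have hopen : IsOpen {w : ℂ | a < w.re} := isOpen_lt continuous_const Complex.continuous_re
  have hsc := isSimplyConnected_of_convex (convex_halfSpace_re_gt a) ⟨(a + 1 : ℝ), by simp⟩
  obtain ⟨ℓ, hℓ, hexp⟩ := exists_differentiableOn_exp_eq hopen hsc (hφ.deriv hopen)
    fun w hw => deriv_ne_zero_of_injOn hopen hφ hinj hw
  refine ⟨fun w => w / 2 + ℓ w, fun w hw => ?_⟩
  have hnhds := hopen.mem_nhds hw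
  have hℓw : HasDerivAt ℓ (deriv (deriv φ) w / deriv φ w) w :=
    hasDerivAt_of_exp_comp_eventuallyEq ((hφ.deriv hopen).hasDerivAt hnhds)
      (hℓ.differentiableAt hnhds).continuousAt (eventually_of_mem hnhds hexp)
  have hderiv := ((hasDerivAt_id w).div_const 2).fun_add hℓw
  refine ⟨?_, hderiv.differentiableAt, ?_⟩
  · rw [add_sub_cancel_left, hexp w hw]
    exact hφ.hasDerivAt hnhds
  · have hball : Metric.ball w (w.re - a) ⊆ {ζ : ℂ | a < ζ.re} := fun ζ hζ => by
      have hre := (Complex.abs_re_le_norm (ζ - w)).trans_lt (mem_ball_iff_norm.1 hζ)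
      rw [Complex.sub_re, abs_lt] at hre
      exact show a < ζ.re by linarith
    have hpos : 0 < ‖deriv φ w‖ := norm_pos_iff.2 (deriv_ne_zero_of_injOn hopen hφ hinj hw)
    rw [show deriv (fun w => w / 2 + ℓ w) w = _ from hderiv.deriv, add_sub_cancel_left, norm_div,
      div_le_iff₀ hpos]
    exact norm_deriv_deriv_le_of_injOn_ball (sub_pos.2 hw) (hφ.mono hball) (hinj.mono hball)

end Distortion

section RealDerivatives

theorem add_mul_sub_le_of_le_deriv {f f' : ℝ → ℝ} {a C : ℝ}
    (hf : ∀ t, a ≤ t → HasDerivAt f (f' t) t) (hC : ∀ t, a ≤ t → C ≤ f' t) {t : ℝ} (ht : a ≤ t) :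
    f a + C * (t - a) ≤ f t := by
  have hgrow := (convex_Ici a).mul_sub_le_image_sub_of_le_deriv (f := f) (C := C)
    (fun s hs => (hf s hs).continuousAt.continuousWithinAt)
    (fun s hs => (hf s (interior_subset hs)).differentiableAt.differentiableWithinAt)
    (fun s hs => (hf s (interior_subset hs)).deriv ▸ hC s (interior_subset hs))
    a Set.self_mem_Ici t ht ht
  linarith

theorem le_of_deriv_neg_of_eq {f f' : ℝ → ℝ} {a B : ℝ}
    (hf : ∀ t, a ≤ t → HasDerivAt f (f' t) t) (ha : f a ≤ B)
    (hB : ∀ t, a ≤ t → f t = B → f' t < 0) {t : ℝ} (ht : a ≤ t) : f t ≤ B :=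
  image_le_of_deriv_right_lt_deriv_boundary
    (fun s hs => (hf s hs.1).continuousAt.continuousWithinAt)
    (fun s hs => (hf s hs.1).hasDerivWithinAt) ha (fun s => hasDerivAt_const s B)
    (fun s hs heq => hB s hs.1 heq) (Set.right_mem_Icc.2 ht)

theorem abs_le_of_deriv_of_abs_eq {f f' : ℝ → ℝ} {a B : ℝ}
    (hf : ∀ t, a ≤ t → HasDerivAt f (f' t) t) (ha : |f a| ≤ B)
    (hB : ∀ t, a ≤ t → f t = B → f' t < 0) (hB' : ∀ t, a ≤ t → f t = -B → 0 < f' t) {t : ℝ}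
    (ht : a ≤ t) : |f t| ≤ B := by
  rw [abs_le'] at ha ⊢
  exact ⟨le_of_deriv_neg_of_eq hf ha.1 hB ht, le_of_deriv_neg_of_eq (fun s hs => (hf s hs).fun_neg)
    ha.2 (fun s hs heq => neg_neg_of_pos (hB' s hs (by linarith))) ht⟩

theorem surjective_of_le_deriv {f f' : ℝ → ℝ} {δ : ℝ} (hδ : 0 < δ)
    (hf : ∀ t, HasDerivAt f (f' t) t) (hle : ∀ t, δ ≤ f' t) : Function.Surjective f := by
  have hgrow : ∀ s t, s ≤ t → f s + δ * (t - s) ≤ f t := fun s t hst =>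
    add_mul_sub_le_of_le_deriv (fun t _ => hf t) (fun t _ => hle t) hst
  have hlin : Tendsto (fun t : ℝ => f 0 + δ * t) atTop atTop :=
    tendsto_atTop_add_const_left _ _ (tendsto_id.const_mul_atTop hδ)
  have hlin' : Tendsto (fun t : ℝ => f 0 + δ * t) atBot atBot :=
    tendsto_atBot_add_const_left _ _ (tendsto_id.const_mul_atBot hδ)
  refine (continuous_iff_continuousAt.2 fun t => (hf t).continuousAt).surjective ?_ ?_
  · refine tendsto_atTop_mono' _ ?_ hlin
    filter_upwards [eventually_ge_atTop 0] with t ht using by linarith [hgrow 0 t ht]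
  · refine tendsto_atBot_mono' _ ?_ hlin'
    filter_upwards [eventually_le_atBot 0] with t ht using by linarith [hgrow t 0 ht]

theorem exists_forall_mem_ball_hasDerivAt_of_norm_le {E : Type*} [NormedAddCommGroup E]
    [NormedSpace ℝ E] [CompleteSpace E] {v : ℝ → E → E} {K B : ℝ≥0}
    (hv : ∀ t, LipschitzWith K (v t)) (hcont : ∀ x, Continuous fun t => v t x)
    (hB : ∀ t x, ‖v t x‖ ≤ B) (t₀ : ℝ) (x₀ : E) (T : ℝ≥0) :
    ∃ γ : ℝ → E, γ t₀ = x₀ ∧ ∀ t ∈ Metric.ball t₀ T, HasDerivAt γ (v t (γ t)) t := by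
  have hmem : t₀ ∈ Set.Icc (t₀ - T) (t₀ + T) :=
    ⟨sub_le_self _ T.coe_nonneg, le_add_of_nonneg_right T.coe_nonneg⟩
  have hPL : IsPicardLindelof v (⟨t₀, hmem⟩ : Set.Icc (t₀ - (T : ℝ)) (t₀ + T)) x₀ (B * T) 0 B K :=
    { lipschitzOnWith := fun t _ => (hv t).lipschitzOnWith
      continuousOn := fun x _ => (hcont x).continuousOn
      norm_le := fun t _ x _ => hB t x
      mul_max_le := by simp }
  obtain ⟨γ, hγ₀, hγ⟩ := hPL.exists_eq_forall_mem_Icc_hasDerivWithinAt₀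
  refine ⟨γ, hγ₀, fun t ht => ?_⟩
  rw [Real.ball_eq_Ioo] at ht
  exact (hγ t (Set.Ioo_subset_Icc_self ht)).hasDerivAt (Icc_mem_nhds ht.1 ht.2)

theorem exists_isIntegralCurve_of_lipschitzWith_of_norm_le {E : Type*} [NormedAddCommGroup E]
    [NormedSpace ℝ E] [CompleteSpace E] {v : ℝ → E → E} {K B : ℝ≥0}
    (hv : ∀ t, LipschitzWith K (v t)) (hcont : ∀ x, Continuous fun t => v t x)
    (hB : ∀ t x, ‖v t x‖ ≤ B) (t₀ : ℝ) (x₀ : E) :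
    ∃ γ : ℝ → E, γ t₀ = x₀ ∧ IsIntegralCurve γ v := by
  choose γ hγ₀ hγ using exists_forall_mem_ball_hasDerivAt_of_norm_le hv hcont hB t₀ x₀
  have huniq : ∀ S T : ℝ≥0, S ≤ T → Set.EqOn (γ S) (γ T) (Metric.ball t₀ S) := by
    intro S T hST t ht
    have hball : Metric.ball t₀ S ⊆ Metric.ball t₀ T := Metric.ball_subset_ball hST
    have hS : t₀ ∈ Metric.ball t₀ S := Metric.mem_ball_self (Metric.pos_of_mem_ball ht)
    rw [Real.ball_eq_Ioo] at ht hS hball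
    exact ODE_solution_unique_of_mem_Ioo (s := fun _ => Set.univ)
      (fun t _ => (hv t).lipschitzOnWith) hS
      (fun t ht => ⟨hγ S t (Real.ball_eq_Ioo _ _ ▸ ht), trivial⟩)
      (fun t ht => ⟨hγ T t (hball ht), trivial⟩) ((hγ₀ S).trans (hγ₀ T).symm) ht
  have hmem : ∀ t : ℝ, t ∈ Metric.ball t₀ (nndist t t₀ + 1 : ℝ≥0) := fun t => by
    simp [Metric.mem_ball]
  refine ⟨fun t => γ (nndist t t₀ + 1) t, hγ₀ _, fun t => ?_⟩
  refine (hγ _ t (hmem t)).congr_of_eventuallyEq ?_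
  filter_upwards [Metric.isOpen_ball.mem_nhds (hmem t)] with s hs
  rcases le_total (nndist s t₀ + 1) (nndist t t₀ + 1) with hle | hle
  · exact huniq _ _ hle (hmem s)
  · exact (huniq _ _ hle hs).symm

end RealDerivatives

section Trajectory

theorem hasDerivAt_re {f : ℝ → ℂ} {f' : ℂ} {t : ℝ} (hf : HasDerivAt f f' t) :
    HasDerivAt (fun s => (f s).re) f'.re t :=
  Complex.reCLM.hasFDerivAt.comp_hasDerivAt t hf

theorem hasDerivAt_im {f : ℝ → ℂ} {f' : ℂ} {t : ℝ} (hf : HasDerivAt f f' t) :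
    HasDerivAt (fun s => (f s).im) f'.im t :=
  Complex.imCLM.hasFDerivAt.comp_hasDerivAt t hf

/-- The unit direction `e^{-iθ}`, with the angle `θ` first clamped to `[-π/4, π/4]`; following it
always moves to the right, whatever `θ` is. -/
noncomputable def clampedDirection (θ : ℝ) : ℂ :=
  Complex.exp
    (-(Set.projIcc (-(Real.pi / 4)) (Real.pi / 4) (by linarith [Real.pi_pos]) θ : ℝ) * Complex.I)

theorem clampedDirection_of_abs_le {θ : ℝ} (hθ : |θ| ≤ Real.pi / 4) :
    clampedDirection θ = Complex.exp (-θ * Complex.I) := by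
  rw [clampedDirection, Set.projIcc_of_mem _ (Set.mem_Icc.2 (abs_le.1 hθ))]

theorem norm_exp_neg_mul_I (θ : ℝ) : ‖Complex.exp (-θ * Complex.I)‖ = 1 := by
  simp [Complex.norm_exp]

theorem norm_clampedDirection (θ : ℝ) : ‖clampedDirection θ‖ = 1 := norm_exp_neg_mul_I _

theorem lipschitzWith_clampedDirection : LipschitzWith 1 clampedDirection := by
  have hderiv : ∀ θ : ℝ, HasDerivAt (fun θ : ℝ => Complex.exp (-θ * Complex.I))
      (Complex.exp (-θ * Complex.I) * (-1 * Complex.I)) θ := fun θ =>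
    ((Complex.ofRealCLM.hasDerivAt (x := θ)).fun_neg.mul_const Complex.I).cexp
  have hexp : LipschitzWith 1 fun θ : ℝ => Complex.exp (-θ * Complex.I) :=
    lipschitzWith_of_nnnorm_deriv_le (fun θ => (hderiv θ).differentiableAt) fun θ => by
      rw [(hderiv θ).deriv, ← NNReal.coe_le_coe, coe_nnnorm, norm_mul, norm_exp_neg_mul_I]
      simp
  have hclamp := (LipschitzWith.subtype_val _).comp
    (LipschitzWith.projIcc (show -(Real.pi / 4) ≤ Real.pi / 4 by linarith [Real.pi_pos]))
  simpa only [mul_one] using! hexp.comp hclamp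

theorem half_le_cos {θ : ℝ} (hθ : |θ| ≤ Real.pi / 4) : 1 / 2 ≤ Real.cos θ := by
  have hcos := Real.cos_le_cos_of_nonneg_of_le_pi (abs_nonneg θ) (by linarith [Real.pi_pos])
    (show |θ| ≤ Real.pi / 3 by linarith [Real.pi_pos])
  rwa [Real.cos_abs, Real.cos_pi_div_three] at hcos

theorem abs_sin_le_cos {θ : ℝ} (hθ : |θ| ≤ Real.pi / 4) : |Real.sin θ| ≤ Real.cos θ := by
  have hcos := Real.cos_le_cos_of_nonneg_of_le_pi (abs_nonneg (2 * θ)) (by linarith [Real.pi_pos])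
    (show |2 * θ| ≤ Real.pi / 2 by rw [abs_mul, abs_two]; linarith)
  rw [Real.cos_abs, Real.cos_pi_div_two, Real.cos_two_mul'] at hcos
  exact abs_le_of_sq_le_sq (by linarith) (by linarith [half_le_cos hθ])

theorem exp_neg_mul_I_re (θ : ℝ) : (Complex.exp (-θ * Complex.I)).re = Real.cos θ := by
  simp [Complex.exp_re]

theorem exp_neg_mul_I_im (θ : ℝ) : (Complex.exp (-θ * Complex.I)).im = -Real.sin θ := by
  simp [Complex.exp_im]

theorem half_le_re_clampedDirection (θ : ℝ) : 1 / 2 ≤ (clampedDirection θ).re := by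
  rw [clampedDirection, exp_neg_mul_I_re]
  exact half_le_cos (abs_le.2 (Set.projIcc _ _ _ θ).2)

theorem half_mul_le_re_mul_exp {c : ℂ} {δ θ : ℝ} (hδ : 0 ≤ δ) (hc : δ ≤ c.re - |c.im|)
    (hθ : |θ| ≤ Real.pi / 4) : δ / 2 ≤ (c * Complex.exp (-θ * Complex.I)).re := by
  have hcos := half_le_cos hθ
  have hsin : |c.im * Real.sin θ| ≤ |c.im| * Real.cos θ := by
    rw [abs_mul]
    exact mul_le_mul_of_nonneg_left (abs_sin_le_cos hθ) (abs_nonneg _)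
  rw [Complex.mul_re, exp_neg_mul_I_re, exp_neg_mul_I_im]
  calc δ / 2 ≤ (c.re - |c.im|) * Real.cos θ := by nlinarith
    _ ≤ c.re * Real.cos θ - c.im * -Real.sin θ := by linarith [neg_abs_le (c.im * Real.sin θ)]

theorem im_mul_clampedDirection_pi_div_four_neg {c : ℂ} (hc : 0 < c.re - |c.im|) :
    (c * clampedDirection (Real.pi / 4)).im < 0 := by
  have hpos : 0 ≤ Real.pi / 4 := by positivity
  rw [clampedDirection_of_abs_le (abs_of_nonneg hpos).le, Complex.mul_im, exp_neg_mul_I_re,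
    exp_neg_mul_I_im, Real.cos_pi_div_four, Real.sin_pi_div_four]
  nlinarith [le_abs_self c.im, Real.sqrt_pos.2 (zero_lt_two' ℝ)]

theorem im_mul_clampedDirection_neg_pi_div_four_pos {c : ℂ} (hc : 0 < c.re - |c.im|) :
    0 < (c * clampedDirection (-(Real.pi / 4))).im := by
  have hpos : 0 ≤ Real.pi / 4 := by positivity
  rw [clampedDirection_of_abs_le (by rw [abs_neg, abs_of_nonneg hpos]), Complex.mul_im,
    exp_neg_mul_I_re, exp_neg_mul_I_im, Real.cos_neg, Real.sin_neg, Real.cos_pi_div_four,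
    Real.sin_pi_div_four]
  nlinarith [neg_abs_le c.im, Real.sqrt_pos.2 (zero_lt_two' ℝ)]

theorem exists_im_eq_zero_of_le_re_deriv {h : ℂ → ℂ} {x δ : ℝ} (hδ : 0 < δ)
    (hd : ∀ w : ℂ, w.re = x → DifferentiableAt ℂ h w)
    (hre : ∀ w : ℂ, w.re = x → δ ≤ (deriv h w).re) : ∃ w : ℂ, w.re = x ∧ (h w).im = 0 := by
  have hline : ∀ v : ℝ, ((x : ℂ) + v * Complex.I).re = x := fun v => by simp
  have hderiv : ∀ v : ℝ, HasDerivAt (fun s : ℝ => (h (x + s * Complex.I)).im)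
      (deriv h (x + v * Complex.I)).re v := fun v => by
    have hvert : HasDerivAt (fun s : ℝ => (x : ℂ) + s * Complex.I) Complex.I v := by
      simpa using ((Complex.ofRealCLM.hasDerivAt (x := v)).mul_const Complex.I).const_add (x : ℂ)
    simpa using hasDerivAt_im ((hd _ (hline v)).hasDerivAt.comp v hvert)
  obtain ⟨v, hv⟩ := surjective_of_le_deriv hδ hderiv (fun v => hre _ (hline v)) 0
  exact ⟨_, hline v, hv⟩

/-- A unit speed curve `w`, followed for times `t ≥ 0`, on which the differential `e^h dw` is
positive: its direction is opposite to the argument `Im h` of `e^h`. We also ask that this argument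
stay in `[-π/4, π/4]`, so that the curve moves to the right. -/
structure IsPositiveTrajectory (h : ℂ → ℂ) (w : ℝ → ℂ) : Prop where
  hasDerivAt : ∀ t, 0 ≤ t → HasDerivAt w (Complex.exp (-(h (w t)).im * Complex.I)) t
  abs_im_le : ∀ t, 0 ≤ t → |(h (w t)).im| ≤ Real.pi / 4

namespace IsPositiveTrajectory

variable {h : ℂ → ℂ} {w : ℝ → ℂ} {t : ℝ}

theorem add_half_mul_le_re (hw : IsPositiveTrajectory h w) (ht : 0 ≤ t) :
    (w 0).re + t / 2 ≤ (w t).re := by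
  have hgrow := add_mul_sub_le_of_le_deriv (C := 1 / 2)
    (fun s hs => hasDerivAt_re (hw.hasDerivAt s hs))
    (fun s hs => by rw [exp_neg_mul_I_re]; exact half_le_cos (hw.abs_im_le s hs)) ht
  linarith

theorem add_half_mul_le_re_comp (hw : IsPositiveTrajectory h w) {δ : ℝ} (hδ : 0 ≤ δ)
    (hd : ∀ s, 0 ≤ s → DifferentiableAt ℂ h (w s))
    (hre : ∀ s, 0 ≤ s → δ ≤ (deriv h (w s)).re - |(deriv h (w s)).im|) (ht : 0 ≤ t) :
    (h (w 0)).re + δ / 2 * t ≤ (h (w t)).re := by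
  have hgrow := add_mul_sub_le_of_le_deriv (f := fun s => (h (w s)).re) (C := δ / 2)
    (fun s hs => hasDerivAt_re ((hd s hs).hasDerivAt.comp s (hw.hasDerivAt s hs)))
    (fun s hs => half_mul_le_re_mul_exp hδ (hre s hs) (hw.abs_im_le s hs)) ht
  simpa only [sub_zero] using hgrow

end IsPositiveTrajectory

theorem lipschitzOnWith_im_of_norm_deriv_le {h : ℂ → ℂ} {S : Set ℂ} {K : ℝ≥0} (hS : Convex ℝ S)
    (hd : ∀ w ∈ S, DifferentiableAt ℂ h w) (hK : ∀ w ∈ S, ‖deriv h w‖ ≤ K) :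
    LipschitzOnWith K (fun w => (h w).im) S := by
  refine LipschitzOnWith.of_dist_le_mul fun z hz w hw => ?_
  rw [Real.dist_eq, dist_eq_norm, ← Complex.sub_im]
  exact (Complex.abs_im_le_norm _).trans (hS.norm_image_sub_le_of_norm_deriv_le hd hK hw hz)

/-- Clamping the direction makes the vector field bounded and globally Lipschitz and confines the
curve to the half-plane. There `|Im h|` cannot pass `π/4`, so that the clamp is never active. -/
theorem exists_isPositiveTrajectory {h : ℂ → ℂ} {x₀ δ : ℝ} {K : ℝ≥0} (hδ : 0 < δ)
    (hd : ∀ w : ℂ, x₀ ≤ w.re → DifferentiableAt ℂ h w)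
    (hK : ∀ w : ℂ, x₀ ≤ w.re → ‖deriv h w‖ ≤ K)
    (hre : ∀ w : ℂ, x₀ ≤ w.re → δ ≤ (deriv h w).re - |(deriv h w).im|) :
    ∃ w : ℝ → ℂ, (w 0).re = x₀ ∧ IsPositiveTrajectory h w := by
  obtain ⟨w₀, hw₀, him₀⟩ := exists_im_eq_zero_of_le_re_deriv hδ (fun w hw => hd w hw.ge)
    fun w hw => (hre w hw.ge).trans (sub_le_self _ (abs_nonneg _))
  obtain ⟨θ, hθlip, hθ⟩ :=
    (lipschitzOnWith_im_of_norm_deriv_le (convex_halfSpace_re_ge x₀) hd hK).extend_real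
  obtain ⟨w, hw0, hw⟩ := exists_isIntegralCurve_of_lipschitzWith_of_norm_le
    (v := fun _ z => clampedDirection (θ z)) (B := 1)
    (fun _ => lipschitzWith_clampedDirection.comp hθlip) (fun _ => continuous_const)
    (fun _ z => (norm_clampedDirection _).le) 0 w₀
  have hright : ∀ t, 0 ≤ t → x₀ ≤ (w t).re := fun t ht => by
    have hgrow := add_mul_sub_le_of_le_deriv (fun s _ => hasDerivAt_re (hw s))
      (fun s _ => half_le_re_clampedDirection (θ (w s))) ht
    rw [hw0, hw₀] at hgrow
    linarith
  have hflow : ∀ t, 0 ≤ t → HasDerivAt w (clampedDirection (h (w t)).im) t := fun t ht => by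
    rw [show (h (w t)).im = θ (w t) from hθ (hright t ht)]
    exact hw t
  have hderiv : ∀ t, 0 ≤ t → HasDerivAt (fun s => (h (w s)).im)
      (deriv h (w t) * clampedDirection (h (w t)).im).im t := fun t ht =>
    hasDerivAt_im ((hd _ (hright t ht)).hasDerivAt.comp t (hflow t ht))
  have hbound : ∀ t, 0 ≤ t → |(h (w t)).im| ≤ Real.pi / 4 := fun t ht =>
    abs_le_of_deriv_of_abs_eq hderiv (by rw [hw0, him₀, abs_zero]; positivity)
      (fun s hs heq => heq ▸ im_mul_clampedDirection_pi_div_four_neg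
        (hδ.trans_le (hre _ (hright s hs))))
      (fun s hs heq => heq ▸ im_mul_clampedDirection_neg_pi_div_four_pos
        (hδ.trans_le (hre _ (hright s hs)))) ht
  exact ⟨w, hw0 ▸ hw₀, fun t ht => clampedDirection_of_abs_le (hbound t ht) ▸ hflow t ht, hbound⟩

end Trajectory

section Oscillator

theorem le_mul_exp_of_deriv_le_mul {E E' k 𝒦 : ℝ → ℝ} {t₀ : ℝ}
    (hE : ∀ t, t₀ ≤ t → HasDerivAt E (E' t) t) (h𝒦 : ∀ t, t₀ ≤ t → HasDerivAt 𝒦 (k t) t)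
    (hle : ∀ t, t₀ ≤ t → E' t ≤ k t * E t) {t : ℝ} (ht : t₀ ≤ t) :
    E t ≤ E t₀ * Real.exp (𝒦 t - 𝒦 t₀) := by
  have hanti := add_mul_sub_le_of_le_deriv (C := 0) (f := fun t => -(E t * Real.exp (-𝒦 t)))
    (fun s hs => ((hE s hs).fun_mul (h𝒦 s hs).fun_neg.exp).fun_neg)
    (fun s hs => by nlinarith [hle s hs, Real.exp_pos (-𝒦 s)]) ht
  calc E t = E t * Real.exp (-𝒦 t) * Real.exp (𝒦 t) := by
        rw [mul_assoc, ← Real.exp_add, neg_add_cancel, Real.exp_zero, mul_one]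
    _ ≤ E t₀ * Real.exp (-𝒦 t₀) * Real.exp (𝒦 t) :=
        mul_le_mul_of_nonneg_right (by linarith) (Real.exp_pos _).le
    _ = E t₀ * Real.exp (𝒦 t - 𝒦 t₀) := by
        rw [mul_assoc, ← Real.exp_add, neg_add_eq_sub]

/-- The rotation `(U, W) ↦ r • (W, -U)` preserves the energy `‖U‖² + ‖W‖²`, so that only the
perturbation contributes to its growth. -/
theorem norm_sq_add_norm_sq_le_of_perturbed_rotation {F : Type*} [NormedAddCommGroup F]
    [InnerProductSpace ℝ F] {U W p : ℝ → F} {r k 𝒦 : ℝ → ℝ} {t₀ : ℝ}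
    (hU : ∀ t, t₀ ≤ t → HasDerivAt U (r t • W t) t)
    (hW : ∀ t, t₀ ≤ t → HasDerivAt W (-(r t • U t) + p t) t)
    (hp : ∀ t, t₀ ≤ t → ‖p t‖ ≤ k t * ‖U t‖) (hk : ∀ t, t₀ ≤ t → 0 ≤ k t)
    (h𝒦 : ∀ t, t₀ ≤ t → HasDerivAt 𝒦 (k t) t) {t : ℝ} (ht : t₀ ≤ t) :
    ‖U t‖ ^ 2 + ‖W t‖ ^ 2 ≤ (‖U t₀‖ ^ 2 + ‖W t₀‖ ^ 2) * Real.exp (𝒦 t - 𝒦 t₀) := by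
  refine le_mul_exp_of_deriv_le_mul (E := fun t => ‖U t‖ ^ 2 + ‖W t‖ ^ 2)
    (fun s hs => (hU s hs).norm_sq.fun_add (hW s hs).norm_sq) h𝒦 (fun s hs => ?_) ht
  calc 2 * inner ℝ (U s) (r s • W s) + 2 * inner ℝ (W s) (-(r s • U s) + p s)
      = 2 * inner ℝ (W s) (p s) := by
        rw [inner_add_right, inner_neg_right, inner_smul_right, inner_smul_right,
          real_inner_comm]
        ring
    _ ≤ 2 * (‖W s‖ * (k s * ‖U s‖)) := by
        gcongr
        exact (real_inner_le_norm _ _).trans (by gcongr; exact hp s hs)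
    _ ≤ k s * (‖U s‖ ^ 2 + ‖W s‖ ^ 2) := by
        nlinarith [mul_nonneg (hk s hs) (sq_nonneg (‖U s‖ - ‖W s‖))]

theorem exists_norm_le_of_exp_decaying_perturbation {F : Type*} [NormedAddCommGroup F]
    [InnerProductSpace ℝ F] {U W p : ℝ → F} {r : ℝ → ℝ} {B c : ℝ} (hB : 0 ≤ B) (hc : 0 < c)
    (hU : ∀ t, 0 ≤ t → HasDerivAt U (r t • W t) t)
    (hW : ∀ t, 0 ≤ t → HasDerivAt W (-(r t • U t) + p t) t)
    (hp : ∀ t, 0 ≤ t → ‖p t‖ ≤ B * Real.exp (-(c * t)) * ‖U t‖) :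
    ∃ C, ∀ t, 0 ≤ t → ‖U t‖ ≤ C := by
  set 𝒦 : ℝ → ℝ := fun t => -(B / c * Real.exp (-(c * t)))
  have h𝒦 : ∀ t, HasDerivAt 𝒦 (B * Real.exp (-(c * t))) t := fun t => by
    refine ((((hasDerivAt_id t).const_mul c).fun_neg.exp).const_mul
      (B / c)).fun_neg.congr_deriv ?_
    simp only [id]
    field_simp
  refine ⟨√((‖U 0‖ ^ 2 + ‖W 0‖ ^ 2) * Real.exp (0 - 𝒦 0)), fun t ht => Real.le_sqrt_of_sq_le ?_⟩
  have henergy := norm_sq_add_norm_sq_le_of_perturbed_rotation hU hW hp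
    (fun s _ => by positivity) (fun s _ => h𝒦 s) ht
  have h𝒦t : 𝒦 t ≤ 0 := neg_nonpos.2 (by positivity)
  refine (le_add_of_nonneg_right (sq_nonneg _)).trans (henergy.trans ?_)
  gcongr

end Oscillator

section Liouville

/-- The first component `U = A^{1/4} y` of the Liouville transform of `y` in the coordinate
`z = φ w`, where `A (φ w) = e^w`. -/
noncomputable def liouvilleFst (φ y : ℂ → ℂ) (w : ℂ) : ℂ :=
  Complex.exp (w / 4) * y (φ w)

/-- The second component `W = e^{-h} dU/dw` of the Liouville transform of `y` in the coordinate
`z = φ w`, where `φ' = e^{h - w/2}`. It is spelled out through `y'` so that it makes sense without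
differentiating `U`. -/
noncomputable def liouvilleSnd (φ h y : ℂ → ℂ) (w : ℂ) : ℂ :=
  Complex.exp (-(w / 4)) * deriv y (φ w) + liouvilleFst φ y w * Complex.exp (-h w) / 4

variable {A φ h y : ℂ → ℂ}

theorem hasDerivAt_liouvilleFst {w : ℂ} (hy : DifferentiableAt ℂ y (φ w))
    (hφ : HasDerivAt φ (Complex.exp (h w - w / 2)) w) :
    HasDerivAt (liouvilleFst φ y) (Complex.exp (h w) * liouvilleSnd φ h y w) w := by
  refine (((hasDerivAt_id w).div_const 4).cexp.fun_mul (hy.hasDerivAt.comp w hφ)).congr_deriv ?_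
  have hhalf : Complex.exp (w / 2) = Complex.exp (w / 4) ^ 2 := by
    rw [← Complex.exp_nat_mul]
    ring_nf
  simp only [liouvilleSnd, liouvilleFst, Complex.exp_sub, Complex.exp_neg, hhalf, id,
    Function.comp_apply]
  field_simp
  ring

theorem hasDerivAt_liouvilleSnd {w h' : ℂ} (hy : IsSolution A y)
    (hφ : HasDerivAt φ (Complex.exp (h w - w / 2)) w) (hh : HasDerivAt h h' w)
    (hA : A (φ w) = Complex.exp w) :
    HasDerivAt (liouvilleSnd φ h y) (-(Complex.exp (h w) * liouvilleFst φ y w) +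
      (1 / 4 - h') * Complex.exp (-h w) / 4 * liouvilleFst φ y w) w := by
  have hy' : Differentiable ℂ (deriv y) := (hy.1.contDiff (n := 2)).differentiable_deriv_two
  refine ((((hasDerivAt_id w).div_const 4).fun_neg.cexp.fun_mul
    ((hy' (φ w)).hasDerivAt.comp w hφ)).fun_add (((hasDerivAt_liouvilleFst (hy.1 (φ w))
      hφ).fun_mul hh.fun_neg.cexp).div_const 4)).congr_deriv ?_
  have hode : deriv (deriv y) (φ w) = -(Complex.exp w * y (φ w)) := by
    rw [← hA]
    linear_combination hy.2 (φ w)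
  have hhalf : Complex.exp (w / 2) = Complex.exp (w / 4) ^ 2 := by
    rw [← Complex.exp_nat_mul]
    ring_nf
  have hone : Complex.exp w = Complex.exp (w / 4) ^ 4 := by
    rw [← Complex.exp_nat_mul]
    ring_nf
  rw [hode]
  simp only [liouvilleSnd, liouvilleFst, Complex.exp_sub, Complex.exp_neg, hhalf, hone, id,
    Function.comp_apply]
  field_simp
  ring

theorem norm_eq_exp_mul_norm_liouvilleFst (w : ℂ) :
    ‖y (φ w)‖ = Real.exp (-(w.re / 4)) * ‖liouvilleFst φ y w‖ := by
  have hre : (w / 4).re = w.re / 4 := by simp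
  rw [liouvilleFst, norm_mul, Complex.norm_exp, hre, ← mul_assoc, ← Real.exp_add, neg_add_cancel,
    Real.exp_zero, one_mul]

theorem exp_mul_exp_neg_im_mul_I (ζ : ℂ) :
    Complex.exp ζ * Complex.exp (-ζ.im * Complex.I) = (Real.exp ζ.re : ℝ) := by
  rw [← Complex.exp_add, Complex.ofReal_exp]
  congr 1
  linear_combination -Complex.re_add_im ζ

namespace IsPositiveTrajectory

variable {w : ℝ → ℂ} {δ K : ℝ}

theorem hasDerivAt_liouvilleFst_comp (hw : IsPositiveTrajectory h w) {t : ℝ} (ht : 0 ≤ t)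
    (hy : DifferentiableAt ℂ y (φ (w t)))
    (hφ : HasDerivAt φ (Complex.exp (h (w t) - w t / 2)) (w t)) :
    HasDerivAt (fun s => liouvilleFst φ y (w s))
      (Real.exp (h (w t)).re • liouvilleSnd φ h y (w t)) t := by
  refine ((hasDerivAt_liouvilleFst hy hφ).comp t (hw.hasDerivAt t ht)).congr_deriv ?_
  rw [Complex.real_smul, ← exp_mul_exp_neg_im_mul_I]
  ring

theorem hasDerivAt_liouvilleSnd_comp (hw : IsPositiveTrajectory h w) {t : ℝ} (ht : 0 ≤ t)
    (hy : IsSolution A y) (hφ : HasDerivAt φ (Complex.exp (h (w t) - w t / 2)) (w t))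
    (hh : DifferentiableAt ℂ h (w t)) (hA : A (φ (w t)) = Complex.exp (w t)) :
    HasDerivAt (fun s => liouvilleSnd φ h y (w s))
      (-(Real.exp (h (w t)).re • liouvilleFst φ y (w t)) +
        (1 / 4 - deriv h (w t)) / 4 * Complex.exp (-h (w t)) * liouvilleFst φ y (w t) *
          Complex.exp (-(h (w t)).im * Complex.I)) t := by
  refine ((hasDerivAt_liouvilleSnd hy hφ hh.hasDerivAt hA).comp t
    (hw.hasDerivAt t ht)).congr_deriv ?_
  rw [Complex.real_smul, ← exp_mul_exp_neg_im_mul_I]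
  ring

theorem exists_norm_liouvilleFst_le (hw : IsPositiveTrajectory h w) (hy : IsSolution A y)
    (hφ : ∀ t, 0 ≤ t → HasDerivAt φ (Complex.exp (h (w t) - w t / 2)) (w t))
    (hA : ∀ t, 0 ≤ t → A (φ (w t)) = Complex.exp (w t))
    (hd : ∀ t, 0 ≤ t → DifferentiableAt ℂ h (w t)) (hδ : 0 < δ)
    (hK : ∀ t, 0 ≤ t → ‖deriv h (w t)‖ ≤ K)
    (hre : ∀ t, 0 ≤ t → δ ≤ (deriv h (w t)).re - |(deriv h (w t)).im|) :
    ∃ C, ∀ t, 0 ≤ t → ‖liouvilleFst φ y (w t)‖ ≤ C := by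
  have hK₀ : 0 ≤ K := (norm_nonneg _).trans (hK 0 le_rfl)
  refine exists_norm_le_of_exp_decaying_perturbation
    (B := (1 + K) * Real.exp (-(h (w 0)).re)) (by positivity) (half_pos hδ)
    (fun t ht => hw.hasDerivAt_liouvilleFst_comp ht (hy.1 _) (hφ t ht))
    (fun t ht => hw.hasDerivAt_liouvilleSnd_comp ht hy (hφ t ht) (hd t ht) (hA t ht))
    fun t ht => ?_
  have hcoeff : ‖(1 / 4 - deriv h (w t)) / 4‖ ≤ 1 + K := by
    have htri := norm_sub_le (1 / 4) (deriv h (w t))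
    norm_num at htri ⊢
    linarith [hK t ht]
  have hexp : ‖Complex.exp (-h (w t))‖ ≤
      Real.exp (-(h (w 0)).re) * Real.exp (-(δ / 2 * t)) := by
    rw [Complex.norm_exp, Complex.neg_re, ← Real.exp_add, ← neg_add]
    gcongr
    exact hw.add_half_mul_le_re_comp hδ.le hd hre ht
  rw [norm_mul, norm_exp_neg_mul_I, mul_one, norm_mul, norm_mul, mul_assoc (1 + K)]
  gcongr

theorem tendsto_re_atTop (hw : IsPositiveTrajectory h w) :
    Tendsto (fun t => (w t).re) atTop atTop := by
  refine tendsto_atTop_mono' _ ?_ (tendsto_atTop_add_const_left _ (w 0).re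
    (tendsto_id.atTop_div_const zero_lt_two))
  filter_upwards [eventually_ge_atTop 0] with t ht using hw.add_half_mul_le_re ht

theorem tendsto_zero_of_isSolution (hw : IsPositiveTrajectory h w) (hy : IsSolution A y)
    (hφ : ∀ t, 0 ≤ t → HasDerivAt φ (Complex.exp (h (w t) - w t / 2)) (w t))
    (hA : ∀ t, 0 ≤ t → A (φ (w t)) = Complex.exp (w t))
    (hd : ∀ t, 0 ≤ t → DifferentiableAt ℂ h (w t)) (hδ : 0 < δ)
    (hK : ∀ t, 0 ≤ t → ‖deriv h (w t)‖ ≤ K)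
    (hre : ∀ t, 0 ≤ t → δ ≤ (deriv h (w t)).re - |(deriv h (w t)).im|) :
    Tendsto (fun t => y (φ (w t))) atTop (𝓝 0) := by
  obtain ⟨C, hC⟩ := hw.exists_norm_liouvilleFst_le hy hφ hA hd hδ hK hre
  have hdecay : Tendsto (fun t => Real.exp (-((w t).re / 4)) * C) atTop (𝓝 0) := by
    simpa only [zero_mul, Function.comp_def] using (Real.tendsto_exp_neg_atTop_nhds_zero.comp
      (hw.tendsto_re_atTop.atTop_div_const zero_lt_four)).mul_const C
  refine squeeze_zero_norm' ?_ hdecay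
  filter_upwards [eventually_ge_atTop 0] with t ht
  rw [norm_eq_exp_mul_norm_liouvilleFst]
  gcongr
  exact hC t ht

end IsPositiveTrajectory

end Liouville

section Singularity

theorem IsSingularityNhd.eventually_mem {f : ℂ → ℂ} {γ : ℝ≥0 → ℂ} {M : ℝ} {Ω : Set ℂ}
    (hΩ : IsSingularityNhd f γ M Ω) (hγ : Tendsto γ atTop (Bornology.cobounded ℂ)) :
    ∀ᶠ t in atTop, γ t ∈ Ω := by
  filter_upwards [hγ.eventually (Bornology.isBounded_def.1 hΩ.2.2)] with t ht
  by_contra hmem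
  exact ht ⟨Set.mem_range_self t, hmem⟩

theorem IsSingularityNhd.subset_of_isPreconnected {f : ℂ → ℂ} {γ : ℝ≥0 → ℂ} {M : ℝ}
    {Ω S : Set ℂ} (hΩ : IsSingularityNhd f γ M Ω) (hγ : Tendsto γ atTop (Bornology.cobounded ℂ))
    (hS : IsPreconnected S) (hSM : ∀ z ∈ S, M < ‖f z‖) (hSγ : ∀ᶠ t in atTop, γ t ∈ S) :
    S ⊆ Ω := by
  obtain ⟨t, htΩ, htS⟩ := ((hΩ.eventually_mem hγ).and hSγ).exists
  obtain ⟨z₀, -, rfl⟩ := hΩ.2.1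
  rw [connectedComponentIn_eq htΩ]
  exact hS.subset_connectedComponentIn htS hSM

theorem IsLogarithmicSingularity.exists_univalent_inverse {f : ℂ → ℂ} {γ : ℝ≥0 → ℂ}
    (hf : Continuous f) (hγ : IsLogarithmicSingularity f γ) :
    ∃ (a : ℝ) (φ : ℂ → ℂ), DifferentiableOn ℂ φ {w | a < w.re} ∧
      Set.InjOn φ {w | a < w.re} ∧ (∀ w : ℂ, a < w.re → f (φ w) = Complex.exp w) ∧
        ∀ b, ∀ᶠ t in atTop, γ t ∈ φ '' {w | b < w.re} := by
  obtain ⟨⟨⟨-, hγ⟩, hfγ⟩, M₀, Ω₀, hΩ₀, L, hL, hexp, hbij⟩ := hγ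
  have hopen : IsOpen Ω₀ := by
    obtain ⟨z₀, -, rfl⟩ := hΩ₀.2.1
    exact (isOpen_lt continuous_const hf.norm).connectedComponentIn
  have hinv := hbij.invOn_invFunOn
  have hmaps := hbij.surjOn.mapsTo_invFunOn
  refine ⟨Real.log M₀, Function.invFunOn L Ω₀, fun w hw => ?_, hinv.2.injOn, fun w hw => ?_,
    fun b => ?_⟩
  · have hdiff := differentiableAt_of_leftInvOn hopen hL hinv.1 (hmaps hw)
    rw [hinv.2 hw] at hdiff
    exact hdiff.differentiableWithinAt
  · rw [← hexp _ (hmaps hw), hinv.2 hw]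
  · filter_upwards [hΩ₀.eventually_mem hγ, (tendsto_norm_cobounded_atTop.comp
      hfγ).eventually_gt_atTop (Real.exp b)] with t ht hbig
    refine ⟨L (γ t), ?_, hinv.1 ht⟩
    rwa [Function.comp_apply, ← hexp _ ht, Complex.norm_exp, Real.exp_lt_exp] at hbig

theorem image_subset_of_isSingularityNhd {f φ : ℂ → ℂ} {γ : ℝ≥0 → ℂ} {M b : ℝ} {Ω : Set ℂ}
    (hΩ : IsSingularityNhd f γ M Ω) (hγ : Tendsto γ atTop (Bornology.cobounded ℂ))
    (hφ : ContinuousOn φ {w | b < w.re}) (hf : ∀ w : ℂ, b < w.re → f (φ w) = Complex.exp w)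
    (hγφ : ∀ᶠ t in atTop, γ t ∈ φ '' {w | b < w.re}) (hb : Real.log M ≤ b) :
    φ '' {w | b < w.re} ⊆ Ω := by
  refine hΩ.subset_of_isPreconnected hγ
    ((convex_halfSpace_re_gt b).isPreconnected.image φ hφ) ?_ hγφ
  rintro _ ⟨w, hw, rfl⟩
  rw [hf w hw, Complex.norm_exp, ← Real.log_lt_iff_lt_exp hΩ.1]
  exact hb.trans_lt hw

theorem tendsto_cobounded_of_comp {ι X Y : Type*} [PseudoMetricSpace X] [ProperSpace X]
    [PseudoMetricSpace Y] {f : X → Y} {u : ι → X} {l : Filter ι} (hf : Continuous f)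
    (hfu : Tendsto (fun i => f (u i)) l (Bornology.cobounded Y)) :
    Tendsto u l (Bornology.cobounded X) := by
  refine (tendsto_comap_iff.2 hfu).mono_right (Bornology.comap_cobounded_le_iff.2 fun s hs => ?_)
  exact (hs.isCompact_closure.image hf).isBounded.subset (Set.image_mono subset_closure)

end Singularity

theorem sub_two_mul_le_re_sub_abs_im {c : ℂ} {x r : ℝ} (hc : ‖c - x‖ ≤ r) :
    x - 2 * r ≤ c.re - |c.im| := by
  have hre := (Complex.abs_re_le_norm _).trans hc
  have him := (Complex.abs_im_le_norm _).trans hc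
  rw [Complex.sub_re, Complex.ofReal_re, abs_le] at hre
  rw [Complex.sub_im, Complex.ofReal_im, sub_zero] at him
  linarith

theorem exists_isPositiveTrajectory_tendsto_zero {A φ : ℂ → ℂ} {a : ℝ}
    (hφ : DifferentiableOn ℂ φ {w | a < w.re}) (hinj : Set.InjOn φ {w | a < w.re})
    (hA : ∀ w : ℂ, a < w.re → A (φ w) = Complex.exp w) {b : ℝ} (hab : a ≤ b) :
    ∃ w : ℝ → ℂ, (∀ t, 0 ≤ t → b < (w t).re) ∧ ContinuousOn w (Set.Ici 0) ∧
      Tendsto (fun t => (w t).re) atTop atTop ∧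
      ∀ y, IsSolution A y → Tendsto (fun t => y (φ (w t))) atTop (𝓝 0) := by
  obtain ⟨h, hh⟩ := exists_hasDerivAt_exp_sub_half hφ hinj
  set x₀ := b + 8 * 1760
  have hx₀ : ∀ w : ℂ, x₀ ≤ w.re → a < w.re := fun w hw => by linarith
  have hnear : ∀ w : ℂ, x₀ ≤ w.re → ‖deriv h w - 1 / 2‖ ≤ 1 / 8 := fun w hw => by
    refine (hh w (hx₀ w hw)).2.2.trans ?_
    rw [div_le_div_iff₀ (sub_pos.2 (hx₀ w hw)) (by norm_num)]
    linarith
  have hd : ∀ w : ℂ, x₀ ≤ w.re → DifferentiableAt ℂ h w := fun w hw => (hh w (hx₀ w hw)).2.1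
  have hK : ∀ w : ℂ, x₀ ≤ w.re → ‖deriv h w‖ ≤ (1 : ℝ≥0) := fun w hw => by
    have htri := norm_add_le (deriv h w - 1 / 2) (1 / 2)
    norm_num at htri
    rw [NNReal.coe_one]
    linarith [hnear w hw]
  have hre : ∀ w : ℂ, x₀ ≤ w.re → 1 / 4 ≤ (deriv h w).re - |(deriv h w).im| := fun w hw => by
    have hsub := sub_two_mul_le_re_sub_abs_im (x := 1 / 2) (r := 1 / 8)
      (by simpa using hnear w hw)
    linarith
  obtain ⟨w, hw0, hw⟩ := exists_isPositiveTrajectory (by norm_num) hd hK hre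
  have hmem : ∀ t, 0 ≤ t → x₀ ≤ (w t).re := fun t ht => by
    linarith [hw.add_half_mul_le_re ht]
  refine ⟨w, fun t ht => by linarith [hmem t ht],
    fun t ht => (hw.hasDerivAt t ht).continuousAt.continuousWithinAt, hw.tendsto_re_atTop,
    fun y hy => hw.tendsto_zero_of_isSolution hy (fun t ht => (hh _ (hx₀ _ (hmem t ht))).1)
      (fun t ht => hA _ (hx₀ _ (hmem t ht))) (fun t ht => hd _ (hmem t ht)) (by norm_num)
      (fun t ht => hK _ (hmem t ht)) (fun t ht => hre _ (hmem t ht))⟩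

theorem mainTheorem6 (A : ℂ → ℂ) (hA : IsTranscendentalEntire A)
    (γ : ℝ≥0 → ℂ) (hγ : IsLogarithmicSingularity A γ)
    (M : ℝ) (Ω : Set ℂ) (hΩ : IsSingularityNhd A γ M Ω) :
    ∃ Γ : ℝ≥0 → ℂ, IsPathToInfinity Γ ∧ (∀ t, Γ t ∈ Ω) ∧
      ∀ y : ℂ → ℂ, IsSolution A y → Tendsto (fun t => y (Γ t)) atTop (𝓝 0) := by
  have hcont : Continuous A := hA.1.continuous
  obtain ⟨a, φ, hφ, hinj, hAφ, hγφ⟩ := hγ.exists_univalent_inverse hcont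
  set b := max a (Real.log M)
  have hab : ∀ w : ℂ, b < w.re → a < w.re := fun w => (le_max_left _ _).trans_lt
  obtain ⟨w, hbw, hw, hre, hdecay⟩ :=
    exists_isPositiveTrajectory_tendsto_zero hφ hinj hAφ (le_max_left a (Real.log M))
  have hsub : φ '' {w | b < w.re} ⊆ Ω := image_subset_of_isSingularityNhd hΩ hγ.1.1.2
    (hφ.continuousOn.mono hab) (fun w hw => hAφ w (hab w hw)) (hγφ b) (le_max_right _ _)
  have hcoe : Tendsto ((↑) : ℝ≥0 → ℝ) atTop atTop := NNReal.tendsto_coe_atTop.2 tendsto_id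
  refine ⟨fun t => φ (w t), ⟨?_, tendsto_cobounded_of_comp hcont ?_⟩,
    fun t => hsub ⟨w t, hbw t t.2, rfl⟩, fun y hy => (hdecay y hy).comp hcoe⟩
  · exact hφ.continuousOn.comp_continuous
      (hw.comp_continuous NNReal.continuous_coe NNReal.coe_nonneg) fun t => hab _ (hbw t t.2)
  · have hAΓ : ∀ t : ℝ≥0, ‖A (φ (w t))‖ = Real.exp (w t).re := fun t => by
      rw [hAφ _ (hab _ (hbw t t.2)), Complex.norm_exp]
    simpa only [← tendsto_norm_atTop_iff_cobounded, hAΓ, Function.comp_def]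
      using Real.tendsto_exp_atTop.comp (hre.comp hcoe)
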